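/- **Setting.** Let $T,r\ge 1$ and let $d_0=1,\,d_1,\dots,d_T,\,d_{T+1}=1$ be layer dimensions ($d_1,\dots,d_T$ are the hidden widths). Let $\sigma:\mathbb R\to\mathbb R$ be either the ReLU function or a bounded, Lipschitz, non-constant function, and fix pre-trained parameters $\theta=(W^{(t)},b^{(t)})_{t=0}^{T}$, $W^{(t)}\in\mathbb R^{d_{t+1}\times d_t}$, $b^{(t)}\in\mathbb R^{d_{t+1}}$. Let $B^{(t)}\in\mathbb R^{d_{t+1}\times r}$, $t=0,\dots,T$, be random matrices whose entries are all i.i.d. standard normal. For $M>0$ let $\mathcal F_M$ be the (random) class of functions $f:\mathbb R\to\mathbb R$ of the form $$f(x)=(W^{(T)}+B^{(T)}A^{(T)})x^{(T)}+b^{(T)},\quad x^{(t+1)}=\sigma\bullet\big((W^{(t)}+B^{(t)}A^{(t)})x^{(t)}+b^{(t)}\big)\ (0\le t<T),\quad x^{(0)}=x,$$ where $A^{(t)}\in[-M,M]^{r\times d_t}$ are arbitrary. Assume $$\eta_\star:=\min_{1\le t\le T}\sqrt{d_t}-\sqrt r>0 .$$ Let $\mathbb P_X$ be a probability measure supported on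 $[0,1]$ with mean $1/2$ and standard deviation $1/2$, and let $(X_1,Y_1),\dots,(X_N,Y_N)$, $N\ge1$, be i.i.d. with law $\mathbb P_X\otimes\delta_0$ and independent of the $B^{(t)}$. Put $\mathcal R(f)=\mathbb E_{(X,Y)\sim\mathbb P_X\otimes\delta_0}|f(X)-Y|$ and $\mathcal R^N(f)=\frac1N\sum_{n=1}^N|f(X_n)-Y_n|$. **Theorem (optimality of the rate in the sample size).** There are an absolute constant $c>0$ and an absolute function $g:\mathbb N\to[0,1]$ with $g(N)=\Theta(1/\sqrt N)$ such that the following holds for all $T,r,(d_t),\theta$ as above. For $\delta$ with $2(T+1)e^{-c\eta_\star^2}<\delta<2(T+1)$ put $\eta(\delta):=\sqrt{\ln(2(T+1)/\delta)/c}\in(0,\eta_\star)$. 1. For every $\sigma$ as above there is a constant $K>0$, depending only on $T,r,(d_t),\theta,\sigma$ (and not on $\delta$, $N$ or $\mathbb P_X$), such that for every such $\delta$, every $$M\ \ge\ \frac{K}{\eta_\star-\eta(\delta)}$$ (in particular for $M$ equal to the right-hand side), every $N\ge 1$ and every $\mathbb P_X$, $$\mathbb P\Big(\sup_{f\in\mathcal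 F_M}|\mathcal R(f)-\mathcal R^N(f)|>\frac1N\Big)\ \ge\ \Big(1-\frac\delta2\Big)\big(1-g(N)\big).$$ 2. If $\sigma$ is ReLU and all biases $b^{(t)}$ vanish, then for every such $\delta$ the explicit size $$M\ \ge\ \frac{1+\max_{t}\|W^{(t)}\|_{op}}{\eta_\star-\eta(\delta)}$$ is enough: the same inequality holds for all such $M$, all $N\ge1$ and all $\mathbb P_X$, with $g$ replaced by some $g':\mathbb N\to[0,1]$, $g'(N)=\Theta(1/\sqrt N)$, that does not depend on $M$, $N$ or $\mathbb P_X$ (but may depend on $T,r,(d_t),\theta,\delta$). -/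

import Mathlib

open MeasureTheory ProbabilityTheory Filter Asymptotics
open scoped ENNReal

universe u

noncomputable section

/-- The ReLU activation function. -/
def relu (z : ℝ) : ℝ := max z 0

/-- Admissible activation functions: ReLU, or a bounded Lipschitz function that is not constant. -/
def IsActivation (σ : ℝ → ℝ) : Prop :=
  σ = relu ∨
    ((∃ C : ℝ, ∀ z, |σ z| ≤ C) ∧ (∃ L : NNReal, LipschitzWith L σ) ∧ ∃ z z', σ z ≠ σ z')

/-- Parameters `(W⁽ᵗ⁾, b⁽ᵗ⁾)` of an MLP with `T` hidden layers. The layers are numbered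
`t = 0, …, T`; the input has dimension `d 0`, the hidden layers have widths `d 1, …, d T`, and the
output has dimension `d (T + 1)`. -/
structure MLPParams (T : ℕ) (d : ℕ → ℕ) where
  /-- weight matrices -/
  W : (t : Fin (T + 1)) → Matrix (Fin (d (t.val + 1))) (Fin (d t.val)) ℝ
  /-- biases -/
  b : (t : Fin (T + 1)) → Fin (d (t.val + 1)) → ℝ

/-- The vector `x⁽ᵗ⁾` entering layer `t`, with `x⁽⁰⁾ = x` and
`x⁽ᵗ⁺¹⁾ = σ • (W⁽ᵗ⁾ x⁽ᵗ⁾ + b⁽ᵗ⁾)`. -/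
def MLPParams.hidden {T : ℕ} {d : ℕ → ℕ} (σ : ℝ → ℝ) (θ : MLPParams T d) (x : Fin (d 0) → ℝ) :
    (t : ℕ) → t ≤ T → Fin (d t) → ℝ
  | 0, _ => x
  | t + 1, h => fun i =>
      σ ((θ.W ⟨t, by omega⟩).mulVec (θ.hidden σ x t (by omega)) i + θ.b ⟨t, by omega⟩ i)

/-- The function represented by the MLP; the last layer is affine. -/
def MLPParams.realize {T : ℕ} {d : ℕ → ℕ} (σ : ℝ → ℝ) (θ : MLPParams T d) (x : Fin (d 0) → ℝ) :
    Fin (d (T + 1)) → ℝ := fun i =>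
  (θ.W ⟨T, by omega⟩).mulVec (θ.hidden σ x T le_rfl) i + θ.b ⟨T, by omega⟩ i

/-- The frozen LoRA factors `B⁽ᵗ⁾`, of size `d (t + 1) × r`. -/
abbrev FrozenFactors (T r : ℕ) (d : ℕ → ℕ) : Type :=
  (t : Fin (T + 1)) → Matrix (Fin (d (t.val + 1))) (Fin r) ℝ

/-- The trainable LoRA factors `A⁽ᵗ⁾`, of size `r × d t`. -/
abbrev TrainableFactors (T r : ℕ) (d : ℕ → ℕ) : Type :=
  (t : Fin (T + 1)) → Matrix (Fin r) (Fin (d t.val)) ℝ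

/-- The parameters `(W⁽ᵗ⁾ + B⁽ᵗ⁾ A⁽ᵗ⁾, b⁽ᵗ⁾)`. -/
def MLPParams.addLoRA {T r : ℕ} {d : ℕ → ℕ} (θ : MLPParams T d) (B : FrozenFactors T r d)
    (A : TrainableFactors T r d) : MLPParams T d where
  W t := θ.W t + B t * A t
  b t := θ.b t

/-- The class of functions `ℝ → ℝ` obtained from the pre-trained parameters `θ` and the frozen
factors `B` by trainable factors with entries in `[-M, M]`, for one-dimensional output. (It is used
for `d 0 = 1`, where `fun _ => x` is the number `x` read as a vector.) -/
def loraClass {T r : ℕ} {d : ℕ → ℕ} (hout : d (T + 1) = 1) (σ : ℝ → ℝ) (θ : MLPParams T d)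
    (M : ℝ) (B : FrozenFactors T r d) : Set (ℝ → ℝ) :=
  {f | ∃ A : TrainableFactors T r d, (∀ t i j, A t i j ∈ Set.Icc (-M) M) ∧
    f = fun x => (θ.addLoRA B A).realize σ (fun _ => x) (Fin.cast hout.symm 0)}

/-- The true risk for the loss `|ŷ - y|`. -/
def trueRisk (P : Measure (ℝ × ℝ)) (f : ℝ → ℝ) : ℝ := ∫ z, |f z.1 - z.2| ∂P

/-- The empirical risk for the loss `|ŷ - y|`. -/
def empRisk {N : ℕ} (z : Fin N → ℝ × ℝ) (f : ℝ → ℝ) : ℝ :=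
  (1 / (N : ℝ)) * ∑ n, |f (z n).1 - (z n).2|

/-- The worst-case generalization gap `sup_{f ∈ F} |R(f) - R^N(f)|`, with values in `[0, ∞]`. -/
def genGap {N : ℕ} (P : Measure (ℝ × ℝ)) (F : Set (ℝ → ℝ)) (z : Fin N → ℝ × ℝ) : ℝ≥0∞ :=
  ⨆ f ∈ F, ENNReal.ofReal |trueRisk P f - empRisk z f|

/-- A sampling distribution on `[0, 1]` with mean `1/2` and standard deviation `1/2`. -/
structure IsBreaking (PX : Measure ℝ) : Prop where
  prob : IsProbabilityMeasure PX
  supp : PX (Set.Icc 0 1)ᶜ = 0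
  mean : ∫ x, x ∂PX = 1 / 2
  var : Var[fun x => x; PX] = 1 / 4

/-- The frozen factors have i.i.d. standard normal entries, the data are i.i.d. with law `P`, and
the two are independent of each other. -/
structure IsGaussianLoRASample {Ω : Type u} [MeasurableSpace Ω] (μ : Measure Ω) {T r : ℕ}
    {d : ℕ → ℕ} {N : ℕ} (P : Measure (ℝ × ℝ)) (B : Ω → FrozenFactors T r d)
    (Z : Ω → Fin N → ℝ × ℝ) : Prop where
  gaussian : ∀ t i j, HasLaw (fun ω => B ω t i j) (gaussianReal 0 1) μ
  indep_entries : iIndepFun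
    (fun (k : (t : Fin (T + 1)) × (Fin (d (t.val + 1)) × Fin r)) ω => B ω k.1 k.2.1 k.2.2) μ
  data : ∀ n, HasLaw (fun ω => Z ω n) P μ
  indep_data : iIndepFun (fun n ω => Z ω n) μ
  indep : IndepFun
    (fun ω (k : (t : Fin (T + 1)) × (Fin (d (t.val + 1)) × Fin r)) => B ω k.1 k.2.1 k.2.2) Z μ

/-- `η⋆ = min_t √(width of hidden layer t) - √r`. -/
def etaStar (T r : ℕ) (d : ℕ → ℕ) : ℝ :=
  (⨅ t : Fin T, √(d (t.val + 1) : ℝ)) - √(r : ℝ)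

/-- The number `η ≥ 0` with `2 (T + 1) exp (-c η²) = δ` (for `c > 0`, `0 < δ ≤ 2 (T + 1)`). -/
def etaOf (c : ℝ) (T : ℕ) (δ : ℝ) : ℝ := √(Real.log (2 * (T + 1) / δ) / c)

/-- `1 + max_t ‖W⁽ᵗ⁾‖`, with the operator norm for the Euclidean norms. -/
def MLPParams.cPre {T : ℕ} {d : ℕ → ℕ} (θ : MLPParams T d) : ℝ :=
  1 + ⨆ t : Fin (T + 1), ‖(Matrix.toEuclideanLin (θ.W t)).toContinuousLinearMap‖

/-- A `[0, 1]`-valued function of the sample size of exact order `1 / √N`. -/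
def IsRootRate (g : ℕ → ℝ) : Prop :=
  (∀ N, 0 ≤ g N ∧ g N ≤ 1) ∧ g =Θ[atTop] fun N : ℕ => 1 / √(N : ℝ)

end

/-! A law on [0, 1] with mean 1/2 and standard deviation 1/2 must be the fair coin on {0, 1}. If S
of the N inputs equal 1, then R(f) - R^N(f) = -(2S - N)(|f(1)| - |f(0)|) / (2N), so the gap exceeds
1/N once |2S - N| ≥ m and ||f(1)| - |f(0)|| > κ with mκ ≥ 2. The first event depends only on the
data, the second only on the frozen factors, so their probabilities multiply
(`mul_one_sub_rootRate_le_measureReal`). Since the middle binomial coefficient is at most 2^N / √N,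
the first event has probability at least 1 - m/√N (`IsBreaking.one_sub_rootRate_le`).

It remains to find an adapter that separates |f(0)| from |f(1)|. For a general activation this is
possible, with any prescribed gap, whenever no entry of the frozen factors vanishes, hence almost
surely, but with no control on the size of the adapter (`exists_lt_realize`). Continuity from below
turns this into one bound M for κ = 2, so m = 1 and the rate is absolute.

For ReLU without biases f(0) = 0, so f(1) ≠ 0 is enough. A column b of the frozen factor with M‖b‖ >
‖W‖ can activate a neuron in the next layer (`exists_pos_coordinate`), and a Chernoff bound makes
all these columns long at once (`measureReal_sum_sq_le`). Here κ, and with it m and the rate, comes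
from continuity from below. -/

/-! ### Activations, and separating two values by a scalar parameter. -/

theorem continuous_relu : Continuous relu := by
  unfold relu; fun_prop

theorem IsActivation.continuous {σ : ℝ → ℝ} (h : IsActivation σ) : Continuous σ := by
  rcases h with rfl | ⟨-, ⟨L, hL⟩, -⟩
  · exact continuous_relu
  · exact hL.continuous

/-- If |σ| were constant while σ is not, σ would take two opposite values, hence the value 0 by the
intermediate value theorem, and then vanish identically. -/
theorem IsActivation.exists_abs_ne {σ : ℝ → ℝ} (h : IsActivation σ) :
    ∃ z z', |σ z| ≠ |σ z'| := by
  have hc := h.continuous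
  rcases h with rfl | ⟨-, -, z, z', hne⟩
  · exact ⟨1, 0, by norm_num [relu]⟩
  · by_contra! hall
    have h1 : σ z = -σ z' := (abs_eq_abs.mp (hall z z')).resolve_left hne
    have h0 : ∃ w, σ w = 0 := by
      rcases le_total (σ z') 0 with h2 | h2
      · exact mem_range_of_exists_le_of_exists_ge hc ⟨z', h2⟩ ⟨z, by linarith⟩
      · exact mem_range_of_exists_le_of_exists_ge hc ⟨z, by linarith⟩ ⟨z', h2⟩
    obtain ⟨w, hw⟩ := h0
    have hz := hall z w
    have hz' := hall z' w
    rw [hw, abs_zero, abs_eq_zero] at hz hz'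
    exact hne (hz.trans hz'.symm)

/-- A continuous function invariant under a contracting affine map is constant. -/
theorem eq_of_invariant_affine {h : ℝ → ℝ} (hc : Continuous h) {κ c : ℝ} (hκ : |κ| < 1)
    (hinv : ∀ z, h z = h (κ * z + c)) (z z' : ℝ) : h z = h z' := by
  have hκ1 : 1 - κ ≠ 0 := by have := (abs_lt.mp hκ).2; linarith
  set w := c / (1 - κ) with hw
  have hwc : c = w * (1 - κ) := by rw [hw]; field_simp
  have key : ∀ x, h x = h w := by
    intro x
    have hn : ∀ n : ℕ, h (w + κ ^ n * (x - w)) = h x := by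
      intro n
      induction n with
      | zero => congr 1; ring
      | succ n ih =>
        rw [← ih, hinv (w + κ ^ n * (x - w))]
        congr 1
        rw [hwc]; ring
    have h1 : Tendsto (fun n : ℕ => h (w + κ ^ n * (x - w))) atTop (nhds (h w)) := by
      have h2 : Tendsto (fun n : ℕ => w + κ ^ n * (x - w)) atTop (nhds w) := by
        simpa using ((tendsto_pow_atTop_nhds_zero_of_abs_lt_one hκ).mul_const (x - w)).const_add w
      exact (hc.tendsto w).comp h2
    simp only [hn] at h1
    exact tendsto_nhds_unique tendsto_const_nhds h1
  rw [key z, key z']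

/-- Equality for all τ would make h invariant under an affine map of slope x / y, a contraction.
This is why the separation of two inputs is tracked through absolute values: slope ±1 would give no
contradiction. -/
theorem exists_ne_of_abs_lt {h : ℝ → ℝ} (hc : Continuous h) (hne : ∃ z z', h z ≠ h z')
    {x y β : ℝ} (p q : ℝ) (hβ : β ≠ 0) (hxy : |x| < |y|) :
    ∃ τ : ℝ, h (p + β * (τ * x)) ≠ h (q + β * (τ * y)) := by
  by_contra! hall
  have hy : y ≠ 0 := by rintro rfl; simp at hxy; linarith [abs_nonneg x]
  obtain ⟨z, z', hz⟩ := hne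
  -- The affine map comes from solving w = q + βτy for τ and substituting into p + βτx.
  refine hz (eq_of_invariant_affine hc (κ := x / y) (c := p - q * (x / y)) ?_ ?_ z z')
  · rw [abs_div, div_lt_one (abs_pos.mpr hy)]; exact hxy
  · intro w
    have := hall ((w - q) / (β * y))
    rw [show q + β * ((w - q) / (β * y) * y) = w by field_simp; ring] at this
    rw [← this]
    congr 1
    field_simp
    ring

theorem exists_ne_of_abs_ne {h : ℝ → ℝ} (hc : Continuous h) (hne : ∃ z z', h z ≠ h z')
    {x y β : ℝ} (p q : ℝ) (hβ : β ≠ 0) (hxy : |x| ≠ |y|) :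
    ∃ τ : ℝ, h (p + β * (τ * x)) ≠ h (q + β * (τ * y)) := by
  rcases lt_or_gt_of_ne hxy with h1 | h1
  · exact exists_ne_of_abs_lt hc hne p q hβ h1
  · obtain ⟨τ, hτ⟩ := exists_ne_of_abs_lt hc hne q p hβ h1
    exact ⟨τ, hτ.symm⟩

/-- For the output layer, which has no activation: the difference grows at least like |β|(|y| -
|x|)τ, up to the error |p| + |q|. -/
theorem exists_lt_abs_sub_of_abs_lt {x y β : ℝ} (C p q : ℝ) (hβ : β ≠ 0) (hxy : |x| < |y|) :
    ∃ τ : ℝ, C < |q + β * (τ * y)| - |p + β * (τ * x)| := by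
  have hpos : 0 < |y| - |x| := by linarith
  have hβ' := abs_pos.mpr hβ
  set s := (|C| + |p| + |q| + 1) / (|β| * (|y| - |x|)) with hs
  have hs0 : 0 ≤ s := by positivity
  refine ⟨s, ?_⟩
  have h1 : |β| * s * |y| - |q| ≤ |q + β * (s * y)| := by
    have : |β * (s * y)| = |β| * s * |y| := by rw [abs_mul, abs_mul, abs_of_nonneg hs0]; ring
    rw [← this]
    have := abs_sub_abs_le_abs_sub (β * (s * y)) (-q)
    rw [abs_neg, sub_neg_eq_add, add_comm (β * (s * y))] at this
    exact this
  have h2 : |p + β * (s * x)| ≤ |p| + |β| * s * |x| := by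
    have : |β * (s * x)| = |β| * s * |x| := by rw [abs_mul, abs_mul, abs_of_nonneg hs0]; ring
    rw [← this]
    exact abs_add_le _ _
  have h3 : |β| * s * (|y| - |x|) = |C| + |p| + |q| + 1 := by
    rw [hs]; field_simp
  have := le_abs_self C
  nlinarith

theorem exists_lt_abs_abs_sub {x y β : ℝ} (C p q : ℝ) (hβ : β ≠ 0) (hxy : |x| ≠ |y|) :
    ∃ τ : ℝ, C < |(|q + β * (τ * y)| - |p + β * (τ * x)|)| := by
  rcases lt_or_gt_of_ne hxy with h1 | h1
  · obtain ⟨τ, hτ⟩ := exists_lt_abs_sub_of_abs_lt C p q hβ h1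
    exact ⟨τ, hτ.trans_le (le_abs_self _)⟩
  · obtain ⟨τ, hτ⟩ := exists_lt_abs_sub_of_abs_lt C q p hβ h1
    refine ⟨τ, hτ.trans_le ?_⟩
    rw [abs_sub_comm]
    exact le_abs_self _

/-- The vectors entering layer `t` only depend on the layers before `t`. -/
theorem MLPParams.hidden_congr {T : ℕ} {d : ℕ → ℕ} (σ : ℝ → ℝ) {θ θ' : MLPParams T d}
    (x : Fin (d 0) → ℝ) : ∀ (t : ℕ) (ht : t ≤ T),
    (∀ s : Fin (T + 1), s.val < t → θ.W s = θ'.W s ∧ θ.b s = θ'.b s) →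
    θ.hidden σ x t ht = θ'.hidden σ x t ht
  | 0, _, _ => rfl
  | t + 1, ht, h => by
    have ih := MLPParams.hidden_congr σ x t (by omega) fun s hs => h s (by omega)
    obtain ⟨hW, hb⟩ := h ⟨t, by omega⟩ (by simp)
    funext i
    simp only [MLPParams.hidden, ih, hW, hb]

/-! ### Adapting a network one layer at a time. -/

section Networks

variable {T r : ℕ} {d : ℕ → ℕ} (θ : MLPParams T d) (B : FrozenFactors T r d)

theorem hidden_addLoRA_update (σ : ℝ → ℝ) (A : TrainableFactors T r d) (s : Fin (T + 1))
    (a : Matrix (Fin r) (Fin (d s.val)) ℝ) (x : Fin (d 0) → ℝ) :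
    (θ.addLoRA B (Function.update A s a)).hidden σ x s.val (by omega) =
      (θ.addLoRA B A).hidden σ x s.val (by omega) := by
  refine MLPParams.hidden_congr σ x _ _ fun s' hs' => ⟨?_, rfl⟩
  have : s' ≠ s := by rintro rfl; exact lt_irrefl _ hs'
  simp [MLPParams.addLoRA, Function.update_of_ne this]

/-- The preactivation of layer `s` after replacing the trainable factor of that layer. -/
theorem preactivation_update (σ : ℝ → ℝ) (A : TrainableFactors T r d) (s : Fin (T + 1))
    (a : Matrix (Fin r) (Fin (d s.val)) ℝ) (x : Fin (d 0) → ℝ) (i : Fin (d (s.val + 1))) :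
    ((θ.addLoRA B (Function.update A s a)).W s).mulVec
        ((θ.addLoRA B (Function.update A s a)).hidden σ x s.val (by omega)) i =
      (θ.W s).mulVec ((θ.addLoRA B A).hidden σ x s.val (by omega)) i +
      (B s).mulVec (a.mulVec ((θ.addLoRA B A).hidden σ x s.val (by omega))) i := by
  rw [hidden_addLoRA_update]
  simp [MLPParams.addLoRA, Matrix.add_mulVec, Matrix.mulVec_mulVec]

theorem hidden_succ_update (σ : ℝ → ℝ) (A : TrainableFactors T r d) {t : ℕ} (ht : t + 1 ≤ T)
    (a : Matrix (Fin r) (Fin (d t)) ℝ) (x : Fin (d 0) → ℝ) (i : Fin (d (t + 1))) :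
    (θ.addLoRA B (Function.update A ⟨t, by omega⟩ a)).hidden σ x (t + 1) ht i =
      σ ((θ.W ⟨t, by omega⟩).mulVec ((θ.addLoRA B A).hidden σ x t (by omega)) i +
        (B ⟨t, by omega⟩).mulVec (a.mulVec ((θ.addLoRA B A).hidden σ x t (by omega))) i +
        θ.b ⟨t, by omega⟩ i) :=
  congrArg (fun z => σ (z + θ.b ⟨t, by omega⟩ i))
    (preactivation_update θ B σ A ⟨t, by omega⟩ a x i)

theorem realize_update (σ : ℝ → ℝ) (A : TrainableFactors T r d)
    (a : Matrix (Fin r) (Fin (d T)) ℝ) (x : Fin (d 0) → ℝ) (i : Fin (d (T + 1))) :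
    (θ.addLoRA B (Function.update A ⟨T, by omega⟩ a)).realize σ x i =
      (θ.W ⟨T, by omega⟩).mulVec ((θ.addLoRA B A).hidden σ x T le_rfl) i +
        (B ⟨T, by omega⟩).mulVec (a.mulVec ((θ.addLoRA B A).hidden σ x T le_rfl)) i +
        θ.b ⟨T, by omega⟩ i :=
  congrArg (fun z => z + θ.b ⟨T, by omega⟩ i)
    (preactivation_update θ B σ A ⟨T, by omega⟩ a x i)

theorem mulVec_mulVec_single {k m n : ℕ} (b : Matrix (Fin k) (Fin m) ℝ) (j : Fin m) (l : Fin n)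
    (τ : ℝ) (x : Fin n → ℝ) (i : Fin k) :
    b.mulVec ((Matrix.single j l τ).mulVec x) i = b i j * (τ * x l) := by
  rw [Matrix.single_mulVec]
  simp [Matrix.mulVec, dotProduct, Function.update_apply]

/-- Induction on the layer. An adapter with the single entry τ in row j and column l shifts neuron i
by `B s i j` times τ times coordinate l, where l already separates the inputs. Changing layer t
leaves the vector entering it untouched. -/
theorem exists_hidden_abs_ne {σ : ℝ → ℝ} (hc : Continuous σ) (hne : ∃ z z', |σ z| ≠ |σ z'|)
    (j : Fin r) (hB : ∀ t i, B t i j ≠ 0) (hd : ∀ t ≤ T, 0 < d t) {x y : Fin (d 0) → ℝ}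
    (hxy : ∃ i, |x i| ≠ |y i|) : ∀ (t : ℕ) (ht : t ≤ T), ∃ A : TrainableFactors T r d,
      ∃ i, |(θ.addLoRA B A).hidden σ x t ht i| ≠ |(θ.addLoRA B A).hidden σ y t ht i|
  | 0, _ => ⟨fun _ => 0, hxy⟩
  | t + 1, ht => by
    obtain ⟨A, l, hl⟩ := exists_hidden_abs_ne hc hne j hB hd hxy t (by omega)
    let s : Fin (T + 1) := ⟨t, by omega⟩
    let i : Fin (d (t + 1)) := ⟨0, hd _ ht⟩
    obtain ⟨τ, hτ⟩ := exists_ne_of_abs_ne (h := fun z => |σ z|) (by fun_prop) hne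
      ((θ.W s).mulVec ((θ.addLoRA B A).hidden σ x t (by omega)) i + θ.b s i)
      ((θ.W s).mulVec ((θ.addLoRA B A).hidden σ y t (by omega)) i + θ.b s i) (hB s i) hl
    refine ⟨Function.update A s (Matrix.single j l τ), i, ?_⟩
    rw [hidden_succ_update, hidden_succ_update, mulVec_mulVec_single, mulVec_mulVec_single]
    convert hτ using 3 <;> ring

theorem exists_lt_realize {σ : ℝ → ℝ} (hc : Continuous σ) (hne : ∃ z z', |σ z| ≠ |σ z'|)
    (j : Fin r) (hB : ∀ t i, B t i j ≠ 0) (hd : ∀ t ≤ T, 0 < d t) {x y : Fin (d 0) → ℝ}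
    (hxy : ∃ i, |x i| ≠ |y i|) (C : ℝ) (i : Fin (d (T + 1))) : ∃ A : TrainableFactors T r d,
      C < |(|(θ.addLoRA B A).realize σ y i| - |(θ.addLoRA B A).realize σ x i|)| := by
  obtain ⟨A, l, hl⟩ := exists_hidden_abs_ne θ B hc hne j hB hd hxy T le_rfl
  let s : Fin (T + 1) := ⟨T, by omega⟩
  obtain ⟨τ, hτ⟩ := exists_lt_abs_abs_sub C
      ((θ.W s).mulVec ((θ.addLoRA B A).hidden σ x T le_rfl) i + θ.b s i)
      ((θ.W s).mulVec ((θ.addLoRA B A).hidden σ y T le_rfl) i + θ.b s i) (hB s i) hl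
  refine ⟨Function.update A s (Matrix.single j l τ), ?_⟩
  rw [realize_update, realize_update, mulVec_mulVec_single, mulVec_mulVec_single]
  convert hτ using 4 <;> ring

/-! ### ReLU networks without biases. -/

theorem hidden_relu_zero (hb : ∀ t, θ.b t = 0) : ∀ (t : ℕ) (ht : t ≤ T),
    θ.hidden relu 0 t ht = 0
  | 0, _ => rfl
  | t + 1, ht => by
    funext i
    simp [MLPParams.hidden, hidden_relu_zero hb t (by omega), hb, relu]

theorem realize_relu_zero (hb : ∀ t, θ.b t = 0) (i : Fin (d (T + 1))) :
    θ.realize relu 0 i = 0 := by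
  simp [MLPParams.realize, hidden_relu_zero θ hb, hb]

theorem sum_sq_mulVec_le {m n : ℕ} (W : Matrix (Fin m) (Fin n) ℝ) (x : Fin n → ℝ) :
    ∑ i, (W.mulVec x i) ^ 2 ≤
      ‖(Matrix.toEuclideanLin W).toContinuousLinearMap‖ ^ 2 * ∑ i, x i ^ 2 := by
  have h := (Matrix.toEuclideanLin W).toContinuousLinearMap.le_opNorm (WithLp.toLp 2 x)
  have h2 := pow_le_pow_left₀ (norm_nonneg _) h 2
  rw [mul_pow, EuclideanSpace.norm_sq_eq, EuclideanSpace.norm_sq_eq] at h2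
  simpa [Matrix.toLpLin_apply] using h2

/-- One of the two perturbations `± M ‖x‖₁ b` makes a coordinate of `W x` positive as soon as
`M ‖b‖` exceeds the operator norm of `W`. -/
theorem exists_pos_coordinate {m n : ℕ} (W : Matrix (Fin m) (Fin n) ℝ) (b : Fin m → ℝ) {M : ℝ}
    (hM : 0 ≤ M)
    (hb : ‖(Matrix.toEuclideanLin W).toContinuousLinearMap‖ ^ 2 < M ^ 2 * ∑ i, b i ^ 2)
    {x : Fin n → ℝ} (hx : ∀ i, 0 ≤ x i) (hx0 : 0 < ∑ i, x i) :
    ∃ (τ : ℝ) (i : Fin m), |τ| ≤ M ∧ 0 < W.mulVec x i + b i * (τ * ∑ l, x l) := by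
  by_contra! hall
  set w := ‖(Matrix.toEuclideanLin W).toContinuousLinearMap‖
  set S := ∑ l, x l
  have h1 : ∀ i, M ^ 2 * S ^ 2 * b i ^ 2 ≤ (W.mulVec x i) ^ 2 := by
    intro i
    have hp := hall M i (by rw [abs_of_nonneg hM])
    have hm := hall (-M) i (by rw [abs_neg, abs_of_nonneg hM])
    have : |M * S * b i| ≤ |W.mulVec x i| := by
      refine abs_le.mpr ⟨?_, ?_⟩ <;> have := neg_le_abs (W.mulVec x i) <;> nlinarith
    have := sq_le_sq.mpr this
    nlinarith
  have h2 : M ^ 2 * S ^ 2 * ∑ i, b i ^ 2 ≤ w ^ 2 * S ^ 2 := by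
    rw [Finset.mul_sum]
    refine (Finset.sum_le_sum fun i _ => h1 i).trans ((sum_sq_mulVec_le W x).trans ?_)
    -- For nonnegative x the Euclidean norm is at most the sum S of the coordinates.
    exact mul_le_mul_of_nonneg_left (Finset.sum_sq_le_sq_sum_of_nonneg fun i _ => hx i) (sq_nonneg _)
  have : 0 < S ^ 2 := by positivity
  nlinarith

/-- Filling a whole row with τ yields the full ℓ¹ norm of a nonnegative input while each entry stays
within the bound M. -/
theorem mulVec_mulVec_row {k m n : ℕ} (b : Matrix (Fin k) (Fin m) ℝ) (j : Fin m)
    (τ : ℝ) (x : Fin n → ℝ) (i : Fin k) :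
    b.mulVec ((Matrix.of fun j' (_ : Fin n) => if j' = j then τ else 0).mulVec x) i =
      b i j * (τ * ∑ l, x l) := by
  have : (Matrix.of fun j' (_ : Fin n) => if j' = j then τ else 0).mulVec x =
      Pi.single j (τ * ∑ l, x l) := by
    funext j'
    by_cases h : j' = j
    · subst h; simp [Matrix.mulVec, dotProduct, Finset.mul_sum]
    · simp [Matrix.mulVec, dotProduct, h]
  rw [this]
  simp

theorem update_row_mem_Icc {A : TrainableFactors T r d} {M τ : ℝ} (hτ : |τ| ≤ M)
    (hA : ∀ t i l, A t i l ∈ Set.Icc (-M) M) (s : Fin (T + 1)) (j : Fin r) (t : Fin (T + 1))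
    (i : Fin r) (l : Fin (d t.val)) :
    Function.update A s (Matrix.of fun j' _ => if j' = j then τ else 0) t i l
      ∈ Set.Icc (-M) M := by
  by_cases h : t = s
  · subst h
    have hM : 0 ≤ M := (abs_nonneg τ).trans hτ
    by_cases hi : i = j
    · simp only [Function.update_self, Matrix.of_apply, hi, if_true]
      exact abs_le.mp hτ
    · simp [hi, hM]
  · rw [Function.update_of_ne h]; exact hA t i l

theorem exists_hidden_relu_pos (hb : ∀ t, θ.b t = 0) {M : ℝ} (hM : 0 ≤ M) (j : Fin r)
    (hB : ∀ t : Fin (T + 1), t.val < T →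
      ‖(Matrix.toEuclideanLin (θ.W t)).toContinuousLinearMap‖ ^ 2 < M ^ 2 * ∑ i, B t i j ^ 2)
    {x : Fin (d 0) → ℝ} (hx : ∀ i, 0 ≤ x i) (hx0 : 0 < ∑ i, x i) :
    ∀ (t : ℕ) (ht : t ≤ T), ∃ A : TrainableFactors T r d, (∀ t i l, A t i l ∈ Set.Icc (-M) M) ∧
      (∀ i, 0 ≤ (θ.addLoRA B A).hidden relu x t ht i) ∧
      0 < ∑ i, (θ.addLoRA B A).hidden relu x t ht i
  | 0, _ => ⟨fun _ => 0, fun _ _ _ => by simpa using hM, hx, hx0⟩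
  | t + 1, ht => by
    obtain ⟨A, hA, hn, hp⟩ := exists_hidden_relu_pos hb hM j hB hx hx0 t (by omega)
    let s : Fin (T + 1) := ⟨t, by omega⟩
    obtain ⟨τ, i, hτ, hpos⟩ := exists_pos_coordinate (θ.W s) (fun i => B s i j) hM
      (hB s (by simp [s]; omega)) hn hp
    have hnn : ∀ A : TrainableFactors T r d,
        ∀ i, 0 ≤ (θ.addLoRA B A).hidden relu x (t + 1) ht i := fun A i => le_max_right _ _
    refine ⟨Function.update A s (Matrix.of fun j' _ => if j' = j then τ else 0),
      update_row_mem_Icc hτ hA s j, hnn _, ?_⟩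
    refine Finset.sum_pos' (fun i _ => hnn _ i) ⟨i, Finset.mem_univ _, ?_⟩
    rw [hidden_succ_update, mulVec_mulVec_row, hb]
    simpa [relu] using hpos

theorem exists_realize_relu_ne_zero (hb : ∀ t, θ.b t = 0) {M : ℝ} (hM : 0 < M) (j : Fin r)
    (hB : ∀ t : Fin (T + 1), t.val < T →
      ‖(Matrix.toEuclideanLin (θ.W t)).toContinuousLinearMap‖ ^ 2 < M ^ 2 * ∑ i, B t i j ^ 2)
    (i : Fin (d (T + 1))) (hBT : B ⟨T, by omega⟩ i j ≠ 0)
    {x : Fin (d 0) → ℝ} (hx : ∀ i, 0 ≤ x i) (hx0 : 0 < ∑ i, x i) :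
    ∃ A : TrainableFactors T r d, (∀ t i l, A t i l ∈ Set.Icc (-M) M) ∧
      (θ.addLoRA B A).realize relu x i ≠ 0 := by
  obtain ⟨A, hA, -, hp⟩ := exists_hidden_relu_pos θ B hb hM.le j hB hx hx0 T le_rfl
  let s : Fin (T + 1) := ⟨T, by omega⟩
  obtain ⟨τ, hτ, hne⟩ : ∃ τ : ℝ, |τ| ≤ M ∧
      (θ.W s).mulVec ((θ.addLoRA B A).hidden relu x T le_rfl) i +
        B s i j * (τ * ∑ l, (θ.addLoRA B A).hidden relu x T le_rfl l) ≠ 0 := by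
    -- The output is affine in τ with nonzero slope, so it cannot vanish at both τ = 0 and τ = M.
    by_contra! hall
    have h0 := hall 0 (by simpa using hM.le)
    have h1 := hall M (abs_of_pos hM).le
    have : B s i j * (M * ∑ l, (θ.addLoRA B A).hidden relu x T le_rfl l) ≠ 0 :=
      mul_ne_zero hBT (mul_pos hM hp).ne'
    apply this
    linarith
  refine ⟨Function.update A s (Matrix.of fun j' _ => if j' = j then τ else 0),
      update_row_mem_Icc hτ hA s j, ?_⟩
  rw [realize_update, mulVec_mulVec_row, hb]
  simpa using hne

end Networks

/-! ### Anticoncentration of the fair binomial law. -/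

theorem centralBinom_sq_mul_le (n : ℕ) : n.centralBinom ^ 2 * (2 * n + 1) ≤ 16 ^ n := by
  induction n with
  | zero => simp
  | succ n ih =>
    have h := Nat.succ_mul_centralBinom_succ n
    have h1 : (n + 1) ^ 2 * ((n + 1).centralBinom ^ 2 * (2 * (n + 1) + 1)) ≤
        (n + 1) ^ 2 * 16 ^ (n + 1) := by
      calc (n + 1) ^ 2 * ((n + 1).centralBinom ^ 2 * (2 * (n + 1) + 1))
          = ((n + 1) * (n + 1).centralBinom) ^ 2 * (2 * n + 3) := by ring
        _ = 4 * (2 * n + 1) * (2 * n + 3) * (n.centralBinom ^ 2 * (2 * n + 1)) := by rw [h]; ring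
        _ ≤ 4 * (2 * n + 1) * (2 * n + 3) * 16 ^ n := Nat.mul_le_mul_left _ ih
        _ ≤ (n + 1) ^ 2 * 16 ^ (n + 1) := by
          rw [pow_succ 16, mul_comm (16 ^ n), ← mul_assoc]
          exact Nat.mul_le_mul_right _ (by nlinarith)
    exact Nat.le_of_mul_le_mul_left h1 (by positivity)

theorem choose_half_sq_mul_le (N : ℕ) : N.choose (N / 2) ^ 2 * N ≤ 4 ^ N := by
  rcases Nat.even_or_odd' N with ⟨n, rfl | rfl⟩
  · have h := centralBinom_sq_mul_le n
    rw [Nat.mul_div_cancel_left _ two_pos, ← Nat.centralBinom_eq_two_mul_choose,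
      pow_mul]
    norm_num
    exact (Nat.mul_le_mul_left _ (by omega)).trans h
  · have h := centralBinom_sq_mul_le (n + 1)
    have h2 : (n + 1).centralBinom = 2 * (2 * n + 1).choose n := by
      rw [Nat.centralBinom_eq_two_mul_choose, show 2 * (n + 1) = 2 * n + 1 + 1 by ring,
        Nat.choose_succ_succ, Nat.choose_symm_half]
      ring
    rw [show (2 * n + 1) / 2 = n by omega]
    rw [h2] at h
    have h3 : (4 : ℕ) ^ (2 * n + 1) = 4 * 16 ^ n := by
      rw [pow_succ, pow_mul]; norm_num; ring
    rw [h3]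
    rw [pow_succ 16, mul_pow] at h
    have h4 : (2 * n + 1).choose n ^ 2 * (2 * n + 1) ≤
        (2 * n + 1).choose n ^ 2 * (2 * (n + 1) + 1) := Nat.mul_le_mul_left _ (by omega)
    nlinarith

theorem choose_div_two_pow_le (N k : ℕ) (hN : 1 ≤ N) :
    (N.choose k : ℝ) / 2 ^ N ≤ 1 / √(N : ℝ) := by
  have hN' : (0 : ℝ) < N := by exact_mod_cast hN
  have h1 : (N.choose k : ℝ) ≤ N.choose (N / 2) := by exact_mod_cast Nat.choose_le_middle k N
  have h2 : (N.choose (N / 2) : ℝ) ^ 2 * N ≤ 4 ^ N := by exact_mod_cast choose_half_sq_mul_le N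
  rw [div_le_div_iff₀ (by positivity) (by positivity), one_mul]
  refine (mul_le_mul_of_nonneg_right h1 (Real.sqrt_nonneg _)).trans ?_
  refine le_of_sq_le_sq ?_ (by positivity)
  rw [mul_pow, Real.sq_sqrt hN'.le, ← pow_mul, mul_comm N 2, pow_mul]
  norm_num
  exact h2

/-- The condition allows at most m consecutive cardinalities, and each level has at most the middle
binomial coefficient many sets. The sets counted are the nearly balanced ones, the complement of
those behind `unbalanced`. -/
theorem card_unbalanced_le (N m : ℕ) :
    (Finset.univ.filter fun s : Finset (Fin N) => |2 * (s.card : ℤ) - N| < m).card ≤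
      m * N.choose (N / 2) := by
  have hsub : (Finset.univ.filter fun s : Finset (Fin N) => |2 * (s.card : ℤ) - N| < m) ⊆
      (Finset.Ico ((N + 2 - m) / 2) ((N + 2 - m) / 2 + m)).biUnion
        fun k => Finset.powersetCard k Finset.univ := by
    intro s hs
    simp only [Finset.mem_filter, Finset.mem_univ, true_and, abs_lt] at hs
    simp only [Finset.mem_biUnion, Finset.mem_Ico, Finset.mem_powersetCard, Finset.subset_univ,
      true_and, exists_eq_right']
    omega
  refine (Finset.card_le_card hsub).trans (Finset.card_biUnion_le.trans ?_)
  refine (Finset.sum_le_card_nsmul _ _ (N.choose (N / 2)) fun k _ => ?_).trans (by simp)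
  simpa using Nat.choose_le_middle k N

/-- The rate `min 1 (m / √N)`. -/
noncomputable def rootRate (m N : ℕ) : ℝ := min 1 (m / √(N : ℝ))

theorem isRootRate_rootRate {m : ℕ} (hm : 1 ≤ m) : IsRootRate (rootRate m) := by
  refine ⟨fun N => ⟨le_min zero_le_one (by positivity), min_le_left _ _⟩, ?_⟩
  have hm' : (m : ℝ) ≠ 0 := by positivity
  have h1 : rootRate m =ᶠ[atTop] fun N : ℕ => (m : ℝ) * (1 / √(N : ℝ)) := by
    filter_upwards [eventually_ge_atTop (m ^ 2), eventually_ge_atTop 1] with N hN hN1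
    have h2 : (m : ℝ) ≤ √(N : ℝ) := Real.le_sqrt_of_sq_le (by exact_mod_cast hN)
    have h3 : (m : ℝ) / √(N : ℝ) ≤ 1 := div_le_one_of_le₀ h2 (Real.sqrt_nonneg _)
    rw [rootRate, min_eq_right h3, mul_one_div]
  exact h1.trans_isTheta ((isTheta_const_mul_left hm').mpr (isTheta_refl _ _))

/-! ### The sampling distribution -/

/-- The moments give x - x² integral 0, and it is nonnegative on [0, 1]; so x ∈ {0, 1} almost
surely, and the mean fixes the weights. -/
theorem IsBreaking.eq_bernoulli {PX : Measure ℝ} (h : IsBreaking PX) :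
    PX = (2⁻¹ : ℝ≥0∞) • Measure.dirac 0 + (2⁻¹ : ℝ≥0∞) • Measure.dirac 1 := by
  have := h.prob
  have hIcc : ∀ᵐ x ∂PX, x ∈ Set.Icc (0 : ℝ) 1 := h.supp
  have hL2 : MemLp (fun x : ℝ => x) 2 PX := by
    refine MemLp.of_bound (by fun_prop) 1 ?_
    filter_upwards [hIcc] with x hx
    rw [Real.norm_eq_abs, abs_le]
    exact ⟨by linarith [hx.1], hx.2⟩
  have hint : Integrable (fun x : ℝ => x) PX := hL2.integrable (by norm_num)
  have hint2 : Integrable (fun x : ℝ => x ^ 2) PX := hL2.integrable_sq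
  have hsq : ∫ x, x ^ 2 ∂PX = 1 / 2 := by
    have hv := variance_eq_sub hL2
    rw [h.var] at hv
    simp only [Pi.pow_apply, h.mean] at hv
    linarith
  have hzero : ∫ x, (x - x ^ 2) ∂PX = 0 := by
    rw [integral_sub hint hint2, h.mean, hsq, sub_self]
  have hae : (fun x : ℝ => x - x ^ 2) =ᵐ[PX] 0 := by
    refine (integral_eq_zero_iff_of_nonneg_ae ?_ (hint.sub hint2)).mp hzero
    filter_upwards [hIcc] with x hx
    show 0 ≤ x - x ^ 2
    nlinarith [hx.1, hx.2]
  have hmem : ∀ᵐ x ∂PX, x ∈ ({0} ∪ {1} : Set ℝ) := by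
    filter_upwards [hae] with x hx
    have : x * (1 - x) = 0 := by simp only [Pi.zero_apply] at hx; linarith
    rcases mul_eq_zero.mp this with h0 | h1
    · exact Or.inl h0
    · exact Or.inr (by simp; linarith)
  have hdecomp : PX = PX {0} • Measure.dirac 0 + PX {1} • Measure.dirac 1 := by
    conv_lhs => rw [← Measure.restrict_eq_self_of_ae_mem hmem]
    rw [Measure.restrict_union (by simp) (measurableSet_singleton _),
      Measure.restrict_singleton, Measure.restrict_singleton]
  have hone : PX {1} = 2⁻¹ := by
    have hm := h.mean
    rw [hdecomp, integral_add_measure, integral_smul_measure, integral_smul_measure] at hm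
    · simp only [integral_dirac, smul_eq_mul, mul_zero, mul_one, zero_add] at hm
      rw [← ENNReal.ofReal_toReal (measure_ne_top PX {1}), hm,
        one_div, ENNReal.ofReal_inv_of_pos two_pos, ENNReal.ofReal_ofNat]
    · exact (integrable_dirac (by simp)).smul_measure (measure_ne_top _ _)
    · exact (integrable_dirac (by simp)).smul_measure (measure_ne_top _ _)
  have hzero' : PX {0} = 2⁻¹ := by
    have hu : PX Set.univ = 1 := measure_univ
    rw [hdecomp] at hu
    simp only [Measure.add_apply, Measure.smul_apply, measure_univ, smul_eq_mul, mul_one,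
      hone] at hu
    rw [← ENNReal.inv_two_add_inv_two] at hu
    exact (ENNReal.add_left_inj (by simp)).mp hu
  rw [hzero', hone] at hdecomp
  exact hdecomp

theorem IsBreaking.prod_dirac_eq {PX : Measure ℝ} (h : IsBreaking PX) :
    PX.prod (Measure.dirac (0 : ℝ)) =
      (2⁻¹ : ℝ≥0∞) • Measure.dirac (0, 0) + (2⁻¹ : ℝ≥0∞) • Measure.dirac (1, 0) := by
  rw [h.eq_bernoulli, Measure.prod_dirac, Measure.map_add _ _ (by fun_prop), Measure.map_smul,
    Measure.map_smul, Measure.map_dirac' (by fun_prop), Measure.map_dirac' (by fun_prop)]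

theorem IsBreaking.trueRisk_eq {PX : Measure ℝ} (h : IsBreaking PX) (f : ℝ → ℝ) :
    trueRisk (PX.prod (Measure.dirac 0)) f = (|f 0| + |f 1|) / 2 := by
  rw [trueRisk, h.prod_dirac_eq, integral_add_measure, integral_smul_measure,
    integral_smul_measure, integral_dirac, integral_dirac]
  · simp; ring
  · exact (integrable_dirac (by simp)).smul_measure (by simp)
  · exact (integrable_dirac (by simp)).smul_measure (by simp)

/-- The data set with inputs `1` at the indices in `s` and `0` elsewhere, and zero outputs. -/
noncomputable def dataPattern {N : ℕ} (s : Finset (Fin N)) (n : Fin N) : ℝ × ℝ := (if n ∈ s then 1 else 0, 0)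

theorem dataPattern_injective (N : ℕ) : Function.Injective (dataPattern (N := N)) := by
  intro s s' h
  ext n
  have := congrArg Prod.fst (congrFun h n)
  by_cases h1 : n ∈ s <;> by_cases h2 : n ∈ s' <;> simp_all [dataPattern]

theorem empRisk_dataPattern {N : ℕ} (s : Finset (Fin N)) (f : ℝ → ℝ) :
    empRisk (dataPattern s) f = (s.card * |f 1| + (N - s.card) * |f 0|) / N := by
  have : ∀ n, |f (dataPattern s n).1 - (dataPattern s n).2| =
      |f 0| + if n ∈ s then |f 1| - |f 0| else 0 := by
    intro n
    by_cases h : n ∈ s <;> simp [dataPattern, h]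
  rw [empRisk, Finset.sum_congr rfl fun n _ => this n, Finset.sum_add_distrib,
    Finset.sum_ite_mem]
  simp
  ring

theorem IsBreaking.pi_singleton_dataPattern {PX : Measure ℝ} (h : IsBreaking PX) {N : ℕ}
    (s : Finset (Fin N)) :
    Measure.pi (fun _ : Fin N => PX.prod (Measure.dirac (0 : ℝ))) {dataPattern s} =
      (2⁻¹ : ℝ≥0∞) ^ N := by
  have := h.prob
  rw [Measure.pi_singleton]
  have : ∀ n, PX.prod (Measure.dirac (0 : ℝ)) {dataPattern s n} = 2⁻¹ := by
    intro n
    rw [h.prod_dirac_eq]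
    by_cases hn : n ∈ s <;> simp [dataPattern, hn]
  simp [this]

/-- The data patterns in which the numbers of zeros and ones differ by at least `m`. -/
noncomputable def unbalanced (N m : ℕ) : Finset (Fin N → ℝ × ℝ) :=
  (Finset.univ.filter fun s : Finset (Fin N) => (m : ℤ) ≤ |2 * (s.card : ℤ) - N|).image dataPattern

theorem IsBreaking.one_sub_rootRate_le {PX : Measure ℝ} (h : IsBreaking PX) {N : ℕ} (hN : 1 ≤ N)
    (m : ℕ) : 1 - rootRate m N ≤
      (Measure.pi (fun _ : Fin N => PX.prod (Measure.dirac (0 : ℝ)))).real (unbalanced N m) := by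
  have := h.prob
  set ν := Measure.pi (fun _ : Fin N => PX.prod (Measure.dirac (0 : ℝ)))
  have hν : ν.real (unbalanced N m) = (Finset.univ.filter fun s : Finset (Fin N) =>
      (m : ℤ) ≤ |2 * (s.card : ℤ) - N|).card / 2 ^ N := by
    rw [← sum_measureReal_singleton, unbalanced,
      Finset.sum_image fun a _ b _ hab => dataPattern_injective N hab]
    have : ∀ s : Finset (Fin N), ν.real {dataPattern s} = 1 / 2 ^ N := by
      intro s
      rw [Measure.real, h.pi_singleton_dataPattern]
      simp
    simp [this, div_eq_mul_inv]
  have hcard := Finset.card_filter_add_card_filter_not (s := Finset.univ)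
    fun s : Finset (Fin N) => (m : ℤ) ≤ |2 * (s.card : ℤ) - N|
  simp only [not_le, Finset.card_univ, Fintype.card_finset, Fintype.card_fin] at hcard
  have hbad := card_unbalanced_le N m
  have hreal : ((Finset.univ.filter fun s : Finset (Fin N) =>
      (m : ℤ) ≤ |2 * (s.card : ℤ) - N|).card : ℝ) ≥ 2 ^ N - m * N.choose (N / 2) := by
    have h1 : (2 : ℝ) ^ N = ((Finset.univ.filter fun s : Finset (Fin N) =>
      (m : ℤ) ≤ |2 * (s.card : ℤ) - N|).card : ℝ) + (Finset.univ.filter fun s : Finset (Fin N) =>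
      |2 * (s.card : ℤ) - N| < m).card := by exact_mod_cast hcard.symm
    have h2 : ((Finset.univ.filter fun s : Finset (Fin N) =>
      |2 * (s.card : ℤ) - N| < m).card : ℝ) ≤ m * N.choose (N / 2) := by exact_mod_cast hbad
    linarith
  have h0 : 0 ≤ ν.real (unbalanced N m) := measureReal_nonneg
  rw [rootRate, sub_le_comm, le_min_iff]
  refine ⟨by linarith, ?_⟩
  have h3 := mul_le_mul_of_nonneg_left (choose_div_two_pow_le N (N / 2) hN) (Nat.cast_nonneg m)
  have h4 : (2 ^ N - m * N.choose (N / 2) : ℝ) / 2 ^ N ≤ ν.real (unbalanced N m) := by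
    rw [hν]; gcongr
  rw [sub_div, div_self (by positivity), mul_div_assoc] at h4
  rw [mul_one_div] at h3
  linarith

theorem IsBreaking.lt_abs_risk_sub {PX : Measure ℝ} (h : IsBreaking PX) {N : ℕ} (hN : 1 ≤ N)
    {m : ℕ} {κ : ℝ} (hm : 1 ≤ m) (hκ : 2 ≤ m * κ) {z : Fin N → ℝ × ℝ} (hz : z ∈ unbalanced N m)
    {f : ℝ → ℝ} (hf : κ < |(|f 1| - |f 0|)|) :
    1 / (N : ℝ) < |trueRisk (PX.prod (Measure.dirac 0)) f - empRisk z f| := by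
  simp only [unbalanced, Finset.mem_image, Finset.mem_filter, Finset.mem_univ, true_and] at hz
  obtain ⟨s, hs, rfl⟩ := hz
  have hN' : (0 : ℝ) < N := by exact_mod_cast hN
  have hs' : (m : ℝ) ≤ |2 * (s.card : ℝ) - N| := by exact_mod_cast hs
  have hm' : (1 : ℝ) ≤ m := by exact_mod_cast hm
  have heq : trueRisk (PX.prod (Measure.dirac 0)) f - empRisk (dataPattern s) f =
      -((2 * (s.card : ℝ) - N) * (|f 1| - |f 0|) / (2 * N)) := by
    rw [h.trueRisk_eq, empRisk_dataPattern]
    field_simp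
    ring
  rw [heq, abs_neg, abs_div, abs_mul, abs_of_pos (by positivity : (0 : ℝ) < 2 * N),
    div_lt_div_iff₀ hN' (by positivity)]
  have : 2 < |2 * (s.card : ℝ) - N| * |(|f 1| - |f 0|)| := by
    have h1 : (m : ℝ) * κ < m * |(|f 1| - |f 0|)| := by gcongr
    have h2 := mul_le_mul_of_nonneg_right hs' (abs_nonneg (|f 1| - |f 0|))
    linarith
  nlinarith

/-! ### Lower tail of the chi-squared distribution -/

theorem integral_exp_neg_mul_sq_gaussianReal {l : ℝ} (hl : 0 ≤ l) :
    ∫ x, Real.exp (-l * x ^ 2) ∂gaussianReal 0 1 = 1 / √(1 + 2 * l) := by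
  rw [integral_gaussianReal_eq_integral_smul one_ne_zero]
  have : ∀ x : ℝ, gaussianPDFReal 0 1 x • Real.exp (-l * x ^ 2) =
      (√(2 * Real.pi))⁻¹ * Real.exp (-(l + 1 / 2) * x ^ 2) := by
    intro x
    simp only [gaussianPDFReal, smul_eq_mul, NNReal.coe_one, mul_one, sub_zero]
    rw [mul_assoc, ← Real.exp_add]
    congr 2
    ring
  simp_rw [this]
  rw [integral_const_mul, integral_gaussian, ← Real.sqrt_inv, ← Real.sqrt_mul (by positivity),
    ← Real.sqrt_one, ← Real.sqrt_div zero_le_one, Real.sqrt_one]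
  congr 1
  have := Real.pi_pos
  field_simp
  ring

theorem one_div_sqrt_one_add_le {l : ℝ} (hl : 0 ≤ l) :
    1 / √(1 + 2 * l) ≤ Real.exp (-l + 2 * l ^ 2) := by
  have h1 : Real.exp (l - 2 * l ^ 2) ≤ √(1 + 2 * l) := by
    apply Real.le_sqrt_of_sq_le
    rw [← Real.exp_nat_mul, ← Real.le_log_iff_exp_le (by positivity)]
    have h2 := Real.one_sub_inv_le_log_of_pos (by positivity : 0 < 1 + 2 * l)
    refine le_trans ?_ h2
    have h3 : 1 - (1 + 2 * l)⁻¹ - 2 * (l - 2 * l ^ 2) = 8 * l ^ 3 / (1 + 2 * l) := by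
      field_simp; ring
    have h4 : 0 ≤ 8 * l ^ 3 / (1 + 2 * l) := by positivity
    push_cast
    linarith
  rw [show -l + 2 * l ^ 2 = -(l - 2 * l ^ 2) by ring, Real.exp_neg, one_div]
  exact inv_anti₀ (Real.exp_pos _) h1

theorem measureReal_sum_sq_le {ι : Type*} [Fintype ι] {n : ℕ} {g : Fin n → ι}
    (hg : Function.Injective g) {η : ℝ} (hη : 0 ≤ η) (hηn : η ≤ √(n : ℝ)) :
    (Measure.pi fun _ : ι => gaussianReal 0 1).real {e | ∑ i, e (g i) ^ 2 ≤ (√(n : ℝ) - η) ^ 2} ≤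
      Real.exp (-(1 / 8) * η ^ 2) := by
  set γ := Measure.pi fun _ : ι => gaussianReal 0 1
  rcases hη.eq_or_lt with rfl | hη
  · simp
  have hn : 0 < √(n : ℝ) := hη.trans_le hηn
  -- Chernoff parameter. The exponent is at most -lη√n + 2(l√n)², which this choice turns into -η²/4
  -- + η²/8; hence the constant 1/8.
  set l := η / (4 * √(n : ℝ)) with hl
  have hl0 : 0 ≤ l := by positivity
  let X : Fin n → (ι → ℝ) → ℝ := fun i e => e (g i) ^ 2
  have hX : ∀ i, Measurable (X i) := fun i => by fun_prop
  have hind : iIndepFun X γ := by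
    have h1 : iIndepFun (fun (k : ι) (e : ι → ℝ) => (e k) ^ 2) γ :=
      iIndepFun_pi (X := fun (_ : ι) (x : ℝ) => x ^ 2) fun _ => by fun_prop
    exact h1.precomp hg
  have hmgf1 : ∀ i, mgf (X i) γ (-l) = 1 / √(1 + 2 * l) := by
    intro i
    have hmp := measurePreserving_eval (fun _ : ι => gaussianReal 0 1) (g i)
    rw [← integral_exp_neg_mul_sq_gaussianReal hl0, ← hmp.map_eq,
      integral_map hmp.measurable.aemeasurable (by fun_prop)]
    rfl
  have hchern := measure_le_le_exp_mul_mgf (μ := γ) (X := ∑ i, X i) (t := -l)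
    ((√(n : ℝ) - η) ^ 2) (by linarith) (by
      refine Integrable.of_bound (Measurable.aestronglyMeasurable ?_) 1 (ae_of_all _ fun e => ?_)
      · have : Measurable (fun e => ∑ i, X i e) := Finset.measurable_sum _ fun i _ => hX i
        simpa only [Finset.sum_apply] using (this.const_mul (-l)).exp
      · rw [Real.norm_eq_abs, Real.abs_exp, Real.exp_le_one_iff]
        have : 0 ≤ (∑ i, X i) e := by
          rw [Finset.sum_apply]; exact Finset.sum_nonneg fun i _ => sq_nonneg _
        nlinarith)
  rw [hind.mgf_sum hX, Finset.prod_congr rfl fun i _ => hmgf1 i, Finset.prod_const,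
    Finset.card_univ, Fintype.card_fin] at hchern
  have hset : {e : ι → ℝ | ∑ i, e (g i) ^ 2 ≤ (√(n : ℝ) - η) ^ 2} =
      {e | (∑ i, X i) e ≤ (√(n : ℝ) - η) ^ 2} := by
    ext e; simp [X]
  rw [hset]
  refine hchern.trans ?_
  have hpow := pow_le_pow_left₀ (by positivity) (one_div_sqrt_one_add_le hl0) n
  rw [← Real.exp_nat_mul] at hpow
  refine (mul_le_mul_of_nonneg_left hpow (Real.exp_pos _).le).trans ?_
  rw [← Real.exp_add, Real.exp_le_exp]
  have hs : (n : ℝ) = √(n : ℝ) ^ 2 := (Real.sq_sqrt (Nat.cast_nonneg n)).symm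
  have hls : l * √(n : ℝ) = η / 4 := by rw [hl]; field_simp
  have hexp : -(-l) * (√(n : ℝ) - η) ^ 2 + n * (-l + 2 * l ^ 2) =
      l * η * (η - 2 * √(n : ℝ)) + 2 * (l * √(n : ℝ)) ^ 2 := by
    rw [hs, Real.sqrt_sq hn.le]; ring
  rw [hexp, hls]
  have : l * η * (η - 2 * √(n : ℝ)) ≤ l * η * (-√(n : ℝ)) :=
    mul_le_mul_of_nonneg_left (by linarith) (by positivity)
  nlinarith

/-! ### The event of a large gap between the values at `0` and `1` -/

section GapSet

variable {T r : ℕ} {d : ℕ → ℕ}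

/-- The index set of the entries of the frozen factors. -/
abbrev FactorIndex (T r : ℕ) (d : ℕ → ℕ) : Type :=
  (t : Fin (T + 1)) × (Fin (d (t.val + 1)) × Fin r)

/-- The frozen factors with given entries. -/
def factorsOf (e : FactorIndex T r d → ℝ) : FrozenFactors T r d := fun t i j => e ⟨t, i, j⟩

/-- The entries for which some `f` in the LoRA class satisfies `κ < ||f 1| - |f 0||`. -/
def gapSet (hout : d (T + 1) = 1) (σ : ℝ → ℝ) (θ : MLPParams T d) (M κ : ℝ) :
    Set (FactorIndex T r d → ℝ) :=
  {e | ∃ f ∈ loraClass hout σ θ M (factorsOf e), κ < |(|f 1| - |f 0|)|}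

theorem gapSet_mono (hout : d (T + 1) = 1) (σ : ℝ → ℝ) (θ : MLPParams T d) {M M' κ κ' : ℝ}
    (hM : M ≤ M') (hκ : κ' ≤ κ) :
    gapSet (r := r) hout σ θ M κ ⊆ gapSet hout σ θ M' κ' := by
  rintro e ⟨f, ⟨A, hA, hf⟩, hgap⟩
  exact ⟨f, ⟨A, fun t i j => Set.Icc_subset_Icc (neg_le_neg hM) hM (hA t i j), hf⟩,
    hκ.trans_lt hgap⟩

theorem continuous_hidden_addLoRA {σ : ℝ → ℝ} (hσ : Continuous σ) (θ : MLPParams T d)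
    (A : TrainableFactors T r d) (x : Fin (d 0) → ℝ) : ∀ (t : ℕ) (ht : t ≤ T),
    Continuous fun e => (θ.addLoRA (factorsOf e) A).hidden σ x t ht
  | 0, _ => continuous_const
  | t + 1, ht => by
    have ih := continuous_hidden_addLoRA hσ θ A x t (by omega)
    refine continuous_pi fun i => hσ.comp ?_
    simp only [MLPParams.addLoRA, Matrix.mulVec, dotProduct, Matrix.add_apply, Matrix.mul_apply,
      factorsOf]
    refine Continuous.add (continuous_finsetSum _ fun l _ => Continuous.mul (by fun_prop) ?_)
      continuous_const
    exact (continuous_apply l).comp ih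

theorem continuous_realize_addLoRA {σ : ℝ → ℝ} (hσ : Continuous σ) (θ : MLPParams T d)
    (A : TrainableFactors T r d) (x : Fin (d 0) → ℝ) (i : Fin (d (T + 1))) :
    Continuous fun e => (θ.addLoRA (factorsOf e) A).realize σ x i := by
  have ih := continuous_hidden_addLoRA hσ θ A x T le_rfl
  simp only [MLPParams.realize, MLPParams.addLoRA, Matrix.mulVec, dotProduct, Matrix.add_apply,
    Matrix.mul_apply, factorsOf]
  refine Continuous.add (continuous_finsetSum _ fun l _ => Continuous.mul (by fun_prop) ?_)
    continuous_const
  exact (continuous_apply l).comp ih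

/-- Supplies measurability: the union over adapters is uncountable, but each piece is open because
the output is continuous in the frozen entries. -/
theorem isOpen_gapSet (hout : d (T + 1) = 1) {σ : ℝ → ℝ} (hσ : Continuous σ) (θ : MLPParams T d)
    (M κ : ℝ) : IsOpen (gapSet (r := r) hout σ θ M κ) := by
  have : gapSet (r := r) hout σ θ M κ = ⋃ A ∈ {A : TrainableFactors T r d |
      ∀ t i j, A t i j ∈ Set.Icc (-M) M}, {e | κ <
        |(|(θ.addLoRA (factorsOf e) A).realize σ (fun _ => 1) (Fin.cast hout.symm 0)| -
          |(θ.addLoRA (factorsOf e) A).realize σ (fun _ => 0) (Fin.cast hout.symm 0)|)|} := by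
    ext e
    simp only [gapSet, loraClass, Set.mem_ofPred_eq, Set.mem_iUnion, exists_prop]
    constructor
    · rintro ⟨f, ⟨A, hA, rfl⟩, h⟩
      exact ⟨A, hA, h⟩
    · rintro ⟨A, hA, h⟩
      exact ⟨_, ⟨A, hA, rfl⟩, h⟩
  rw [this]
  refine isOpen_biUnion fun A _ => isOpen_lt continuous_const ?_
  exact ((continuous_realize_addLoRA hσ θ A _ _).abs.sub
    (continuous_realize_addLoRA hσ θ A _ _).abs).abs

/-- The law of the entries of the frozen factors. -/
noncomputable abbrev factorLaw (T r : ℕ) (d : ℕ → ℕ) : Measure (FactorIndex T r d → ℝ) :=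
  Measure.pi fun _ => gaussianReal 0 1

theorem ae_factorLaw_ne_zero : ∀ᵐ e ∂factorLaw T r d, ∀ k, e k ≠ 0 := by
  have : NullSingletonClass (gaussianReal 0 1) := nullSingletonClass_gaussianReal one_ne_zero
  exact ae_all_iff.mpr fun k => Measure.ae_eval_ne (fun _ => gaussianReal 0 1) k 0

theorem mul_one_sub_rootRate_le_measureReal (hout : d (T + 1) = 1) {σ : ℝ → ℝ}
    (hσ : Continuous σ) (θ : MLPParams T d) {M κ p : ℝ} {m : ℕ} (hm : 1 ≤ m) (hκ : 2 ≤ m * κ)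
    (hp : p ≤ (factorLaw T r d).real (gapSet hout σ θ M κ))
    {N : ℕ} (hN : 1 ≤ N) {PX : Measure ℝ} (hPX : IsBreaking PX)
    {Ω : Type u} [MeasurableSpace Ω] {μ : Measure Ω} [IsProbabilityMeasure μ]
    {B : Ω → FrozenFactors T r d} {Z : Ω → Fin N → ℝ × ℝ}
    (h : IsGaussianLoRASample μ (PX.prod (Measure.dirac 0)) B Z) :
    p * (1 - rootRate m N) ≤ μ.real {ω | ENNReal.ofReal (1 / (N : ℝ)) <
      genGap (PX.prod (Measure.dirac 0)) (loraClass hout σ θ M (B ω)) (Z ω)} := by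
  have := hPX.prob
  have hB := h.indep_entries.hasLaw_pi (μ := fun _ => gaussianReal 0 1)
    fun k : FactorIndex T r d => h.gaussian k.1 k.2.1 k.2.2
  have hZ := h.indep_data.hasLaw_pi h.data
  set E : Ω → FactorIndex T r d → ℝ := fun ω k => B ω k.1 k.2.1 k.2.2
  set U : Set (FactorIndex T r d → ℝ) := gapSet hout σ θ M κ
  set G : Set (Fin N → ℝ × ℝ) := ↑(unbalanced N m)
  have hUm : MeasurableSet U := (isOpen_gapSet hout hσ θ M κ).measurableSet
  have hGm : MeasurableSet G := Finset.measurableSet _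
  have hsub : E ⁻¹' U ∩ Z ⁻¹' G ⊆ {ω | ENNReal.ofReal (1 / (N : ℝ)) <
      genGap (PX.prod (Measure.dirac 0)) (loraClass hout σ θ M (B ω)) (Z ω)} := by
    rintro ω ⟨⟨f, hf, hgap⟩, hz⟩
    have hlt := hPX.lt_abs_risk_sub hN hm hκ hz hgap
    have hN' : (0 : ℝ) < 1 / N := by
      have : (0 : ℝ) < N := by exact_mod_cast hN
      positivity
    exact ((ENNReal.ofReal_lt_ofReal_iff (hN'.trans hlt)).mpr hlt).trans_le
      (le_iSup₂ (f := fun f (_ : f ∈ loraClass hout σ θ M (B ω)) => ENNReal.ofReal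
        |trueRisk (PX.prod (Measure.dirac 0)) f - empRisk (Z ω) f|) f hf)
  refine le_trans ?_ (measureReal_mono hsub)
  have hmul : μ.real (E ⁻¹' U ∩ Z ⁻¹' G) = μ.real (E ⁻¹' U) * μ.real (Z ⁻¹' G) := by
    simp only [Measure.real]
    rw [h.indep.measure_inter_preimage_eq_mul _ _ hUm hGm, ENNReal.toReal_mul]
  have h1 : μ.real (E ⁻¹' U) = (factorLaw T r d).real U := hB.measureReal_eq hUm
  have h2 : μ.real (Z ⁻¹' G) = (Measure.pi fun _ : Fin N =>
      PX.prod (Measure.dirac (0 : ℝ))).real G := hZ.measureReal_eq hGm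
  rw [hmul, h1, h2]
  exact mul_le_mul hp (hPX.one_sub_rootRate_le hN m)
    (sub_nonneg.mpr (min_le_left _ _)) measureReal_nonneg

theorem exists_lt_measureReal_of_iUnion {α : Type*} [MeasurableSpace α] {ν : Measure α}
    [IsFiniteMeasure ν] {s : ℕ → Set α} (hs : Monotone s) {p : ℝ} (hp : p < ν.real (⋃ n, s n)) :
    ∃ n, 1 ≤ n ∧ p < ν.real (s n) := by
  have h := (ENNReal.tendsto_toReal (measure_ne_top ν _)).comp (tendsto_measure_iUnion_atTop (μ := ν) hs)
  obtain ⟨n, hn, hn1⟩ := ((h.eventually_const_lt hp).and (eventually_ge_atTop 1)).exists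
  exact ⟨n, hn1, hn⟩

theorem exists_lt_measureReal_gapSet (hr : 1 ≤ r) (h0 : d 0 = 1) (hout : d (T + 1) = 1)
    (hd : ∀ t ≤ T, 0 < d t) {σ : ℝ → ℝ} (hσ : IsActivation σ) (θ : MLPParams T d) (κ : ℝ)
    {p : ℝ} (hp : p < 1) : ∃ n : ℕ, 1 ≤ n ∧ p < (factorLaw T r d).real (gapSet hout σ θ n κ) := by
  refine exists_lt_measureReal_of_iUnion
    (fun m n hmn => gapSet_mono hout σ θ (Nat.cast_le.mpr hmn) le_rfl) ?_
  suffices h : (factorLaw T r d) (⋃ n : ℕ, gapSet hout σ θ n κ) = 1 by simpa [Measure.real, h]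
  rw [← mem_ae_iff_prob_eq_one
    (MeasurableSet.iUnion fun _ => (isOpen_gapSet hout hσ.continuous θ _ κ).measurableSet)]
  filter_upwards [ae_factorLaw_ne_zero] with e he
  obtain ⟨A, hA⟩ := exists_lt_realize θ (factorsOf e) hσ.continuous hσ.exists_abs_ne
    ⟨0, hr⟩ (fun t i => he _) hd (x := fun _ => 0) (y := fun _ => 1)
    ⟨⟨0, by omega⟩, by simp⟩ κ (Fin.cast hout.symm 0)
  have hbdd : ∃ n : ℕ, ∀ t i j, |A t i j| ≤ n := by
    let S : ℝ := ∑ k : (t : Fin (T + 1)) × (Fin r × Fin (d t.val)), |A k.1 k.2.1 k.2.2|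
    obtain ⟨n, hn⟩ := exists_nat_ge S
    refine ⟨n, fun t i j => le_trans ?_ hn⟩
    exact Finset.single_le_sum
      (f := fun k : (t : Fin (T + 1)) × (Fin r × Fin (d t.val)) => |A k.1 k.2.1 k.2.2|)
      (fun _ _ => abs_nonneg _) (Finset.mem_univ ⟨t, i, j⟩)
  obtain ⟨n, hn⟩ := hbdd
  exact Set.mem_iUnion.mpr ⟨n, _, ⟨A, fun t i j => abs_le.mp (hn t i j), rfl⟩, hA⟩

end GapSet

/-! ### The parameters of the statement -/

section Parameters

variable {T r : ℕ} {d : ℕ → ℕ}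

theorem etaStar_le (hr : 1 ≤ r) (t : Fin T) : etaStar T r d ≤ √(d (t.val + 1) : ℝ) - 1 := by
  have h1 : (⨅ t : Fin T, √(d (t.val + 1) : ℝ)) ≤ √(d (t.val + 1) : ℝ) :=
    ciInf_le (Set.finite_range _).bddBelow t
  have h2 : 1 ≤ √(r : ℝ) := Real.one_le_sqrt.mpr (by exact_mod_cast hr)
  unfold etaStar
  linarith

theorem width_pos (hr : 1 ≤ r) (h0 : d 0 = 1) (hη : 0 < etaStar T r d) :
    ∀ t ≤ T, 0 < d t := by
  intro t ht
  rcases t with _ | t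
  · omega
  · have := etaStar_le hr (d := d) (⟨t, ht⟩ : Fin T)
    have h1 : 0 < √(d (t + 1) : ℝ) := by simp only at this; linarith
    exact_mod_cast Real.sqrt_pos.mp h1

variable {c δ η : ℝ}

theorem etaOf_pos (hc : 0 < c) (hδ0 : 0 < δ) (hδ : δ < 2 * (T + 1)) : 0 < etaOf c T δ := by
  have : 0 < Real.log (2 * (T + 1) / δ) := Real.log_pos ((one_lt_div hδ0).mpr hδ)
  exact Real.sqrt_pos.mpr (by positivity)

theorem exp_etaOf (hc : 0 < c) (hδ0 : 0 < δ) (hδ : δ < 2 * (T + 1)) :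
    2 * (T + 1) * Real.exp (-c * etaOf c T δ ^ 2) = δ := by
  have h1 : 0 < Real.log (2 * (T + 1) / δ) := Real.log_pos ((one_lt_div hδ0).mpr hδ)
  rw [etaOf, Real.sq_sqrt (by positivity), show -c * (Real.log (2 * (T + 1) / δ) / c) =
    -Real.log (2 * (T + 1) / δ) by field_simp, Real.exp_neg, Real.exp_log (by positivity)]
  field_simp

theorem etaOf_lt (hc : 0 < c) (hη : 0 < η) (hδ1 : 2 * (T + 1) * Real.exp (-c * η ^ 2) < δ)
    (hδ : δ < 2 * (T + 1)) : etaOf c T δ < η := by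
  have hδ0 : 0 < δ := lt_trans (by positivity) hδ1
  rw [← exp_etaOf hc hδ0 hδ] at hδ1
  have := Real.exp_lt_exp.mp (lt_of_mul_lt_mul_left hδ1 (by positivity))
  exact lt_of_pow_lt_pow_left₀ 2 hη.le (by nlinarith)

theorem norm_lt_cPre (θ : MLPParams T d) (t : Fin (T + 1)) :
    ‖(Matrix.toEuclideanLin (θ.W t)).toContinuousLinearMap‖ < θ.cPre := by
  have := le_ciSup (f := fun t : Fin (T + 1) =>
    ‖(Matrix.toEuclideanLin (θ.W t)).toContinuousLinearMap‖) (Set.finite_range _).bddAbove t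
  simp only at this
  unfold MLPParams.cPre
  linarith

/-- The union bound has only T terms: the output layer needs just a nonzero entry, which holds
almost surely. On the good event the gap is positive but not bounded below; the strict inequality
for p pays for passing to a fixed κ = 1/(n + 1). -/
theorem exists_lt_measureReal_gapSet_relu (hr : 1 ≤ r) (h0 : d 0 = 1)
    (hout : d (T + 1) = 1) (θ : MLPParams T d) (hb : ∀ t, θ.b t = 0) (hη0 : 0 ≤ η)
    (hη : η < etaStar T r d) {p : ℝ} (hp : p < 1 - T * Real.exp (-(1 / 8) * η ^ 2)) :
    ∃ κ : ℝ, 0 < κ ∧ p < (factorLaw T r d).real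
      (gapSet hout relu θ (θ.cPre / (etaStar T r d - η)) κ) := by
  set M := θ.cPre / (etaStar T r d - η) with hMdef
  have hgap : 0 < etaStar T r d - η := sub_pos.mpr hη
  have hc0 : 0 < θ.cPre := (norm_nonneg _).trans_lt (norm_lt_cPre θ 0)
  have hM : 0 < M := div_pos hc0 hgap
  let j : Fin r := ⟨0, hr⟩
  let bad : Fin T → Set (FactorIndex T r d → ℝ) := fun t =>
    {e | ∑ i, e ⟨t.castSucc, i, j⟩ ^ 2 ≤ (√(d (t.val + 1) : ℝ) - η) ^ 2}
  have hbad : ∀ t, (factorLaw T r d).real (bad t) ≤ Real.exp (-(1 / 8) * η ^ 2) := by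
    intro t
    have h1 := etaStar_le hr (d := d) t
    refine measureReal_sum_sq_le (n := d (t.val + 1))
      (g := fun i => (⟨t.castSucc, i, j⟩ : FactorIndex T r d)) ?_ hη0 (by linarith)
    intro i i' hii
    simpa using hii
  have hbadm : ∀ t, MeasurableSet (bad t) := fun t =>
    measurableSet_le (by fun_prop) measurable_const
  have hgood : 1 - T * Real.exp (-(1 / 8) * η ^ 2) ≤
      (factorLaw T r d).real (⋃ t, bad t)ᶜ := by
    rw [probReal_compl_eq_one_sub (MeasurableSet.iUnion hbadm)]
    have : (factorLaw T r d).real (⋃ t, bad t) ≤ T * Real.exp (-(1 / 8) * η ^ 2) := by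
      refine (measureReal_iUnion_fintype_le _).trans ((Finset.sum_le_sum fun t _ => hbad t).trans ?_)
      simp
    linarith
  have hmem : ∀ᵐ e ∂factorLaw T r d, e ∈ (⋃ t, bad t)ᶜ →
      e ∈ ⋃ n : ℕ, gapSet hout relu θ M (1 / ((n : ℝ) + 1)) := by
    filter_upwards [ae_factorLaw_ne_zero] with e he hgood
    simp only [Set.mem_compl_iff, Set.mem_iUnion, not_exists] at hgood
    obtain ⟨A, hA, hne⟩ := exists_realize_relu_ne_zero θ (factorsOf e) hb hM j (by
      intro t ht
      have h1 := hgood ⟨t.val, ht⟩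
      simp only [bad, Set.mem_ofPred_eq, not_le] at h1
      have h2 := etaStar_le hr (d := d) ⟨t.val, ht⟩
      simp only at h2
      have h3 : (etaStar T r d - η) ^ 2 ≤ (√(d (t.val + 1) : ℝ) - η) ^ 2 :=
        pow_le_pow_left₀ hgap.le (by linarith) 2
      have h4 : θ.cPre = M * (etaStar T r d - η) := by rw [hMdef]; field_simp
      calc _ < θ.cPre ^ 2 := pow_lt_pow_left₀ (norm_lt_cPre θ t) (norm_nonneg _) two_ne_zero
        _ = M ^ 2 * (etaStar T r d - η) ^ 2 := by rw [h4]; ring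
        _ ≤ M ^ 2 * ∑ i, factorsOf e t i j ^ 2 := by
          refine mul_le_mul_of_nonneg_left (h3.trans ?_) (sq_nonneg _)
          exact h1.le)
      (Fin.cast hout.symm 0) (he _) (x := fun _ => 1) (fun _ => zero_le_one) (by simp [h0])
    obtain ⟨n, hn⟩ := exists_nat_one_div_lt (abs_pos.mpr hne)
    refine Set.mem_iUnion.mpr ⟨n, _, ⟨A, hA, rfl⟩, ?_⟩
    have hz : (θ.addLoRA (factorsOf e) A).realize relu (fun _ => 0) (Fin.cast hout.symm 0) = 0 :=
      realize_relu_zero (θ.addLoRA (factorsOf e) A) hb _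
    simp only [hz, abs_zero, sub_zero, abs_abs]
    exact hn
  have hle : (factorLaw T r d).real (⋃ t, bad t)ᶜ ≤ (factorLaw T r d).real
      (⋃ n : ℕ, gapSet hout relu θ M (1 / ((n : ℝ) + 1))) :=
    ENNReal.toReal_mono (measure_ne_top _ _) (measure_mono_ae hmem)
  obtain ⟨n, -, hn⟩ := exists_lt_measureReal_of_iUnion
    (fun m n hmn => gapSet_mono hout relu θ le_rfl (one_div_le_one_div_of_le (by positivity)
      (by gcongr))) (hp.trans_le (hgood.trans hle))
  exact ⟨_, by positivity, hn⟩

end Parameters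

theorem theorem2 :
    ∃ c : ℝ, 0 < c ∧ ∃ g : ℕ → ℝ, IsRootRate g ∧
      ∀ (T r : ℕ) (d : ℕ → ℕ) (_ : 1 ≤ T) (_ : 1 ≤ r) (_ : d 0 = 1) (hout : d (T + 1) = 1)
        (_ : 0 < etaStar T r d) (θ : MLPParams T d),
        -- any admissible activation, any pre-trained parameters, absolute constants in the rate
        (∀ σ : ℝ → ℝ, IsActivation σ → ∃ K : ℝ, 0 < K ∧
          ∀ δ : ℝ, 2 * (T + 1) * Real.exp (-c * etaStar T r d ^ 2) < δ → δ < 2 * (T + 1) →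
          ∀ M : ℝ, K / (etaStar T r d - etaOf c T δ) ≤ M →
          ∀ (N : ℕ) (_ : 1 ≤ N) (PX : Measure ℝ) (_ : IsBreaking PX)
            (Ω : Type u) (_ : MeasurableSpace Ω) (μ : Measure Ω) (_ : IsProbabilityMeasure μ)
            (B : Ω → FrozenFactors T r d) (Z : Ω → Fin N → ℝ × ℝ)
            (_ : IsGaussianLoRASample μ (PX.prod (Measure.dirac 0)) B Z),
            (1 - δ / 2) * (1 - g N) ≤
              μ.real {ω | ENNReal.ofReal (1 / (N : ℝ)) <
                genGap (PX.prod (Measure.dirac 0)) (loraClass hout σ θ M (B ω)) (Z ω)}) ∧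
        -- ReLU without biases: explicit size of `M`
        ((∀ t, θ.b t = 0) →
          ∀ δ : ℝ, 2 * (T + 1) * Real.exp (-c * etaStar T r d ^ 2) < δ → δ < 2 * (T + 1) →
          ∃ g' : ℕ → ℝ, IsRootRate g' ∧
          ∀ M : ℝ, θ.cPre / (etaStar T r d - etaOf c T δ) ≤ M →
          ∀ (N : ℕ) (_ : 1 ≤ N) (PX : Measure ℝ) (_ : IsBreaking PX)
            (Ω : Type u) (_ : MeasurableSpace Ω) (μ : Measure Ω) (_ : IsProbabilityMeasure μ)
            (B : Ω → FrozenFactors T r d) (Z : Ω → Fin N → ℝ × ℝ)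
            (_ : IsGaussianLoRASample μ (PX.prod (Measure.dirac 0)) B Z),
            (1 - δ / 2) * (1 - g' N) ≤
              μ.real {ω | ENNReal.ofReal (1 / (N : ℝ)) <
                genGap (PX.prod (Measure.dirac 0)) (loraClass hout relu θ M (B ω)) (Z ω)}) := by
  have hc : (0 : ℝ) < 1 / 8 := by norm_num
  refine ⟨1 / 8, hc, rootRate 1, isRootRate_rootRate le_rfl, ?_⟩
  intro T r d hT hr h0 hout hη θ
  have hd := width_pos hr h0 hη
  refine ⟨fun σ hσ => ?_, fun hb δ hδ1 hδ => ?_⟩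
  -- This p exceeds 1 - δ/2 for every admissible δ, so n does not depend on δ.
  · obtain ⟨n, hn1, hn⟩ := exists_lt_measureReal_gapSet hr h0 hout hd hσ θ 2
      (p := 1 - (T + 1) * Real.exp (-(1 / 8) * etaStar T r d ^ 2))
      (by have : 0 < (T + 1) * Real.exp (-(1 / 8) * etaStar T r d ^ 2) := by positivity
          linarith)
    have hn0 : (0 : ℝ) < n := by exact_mod_cast hn1
    -- With this K, the quotient K / (η⋆ - η(δ)) is at least n because 0 < η(δ) < η⋆.
    refine ⟨n * etaStar T r d, by positivity, ?_⟩
    intro δ hδ1 hδ M hM N hN PX hPX Ω _ μ _ B Z hS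
    have hδ0 : 0 < δ := lt_trans (by positivity) hδ1
    have hlt := etaOf_lt hc hη hδ1 hδ
    have hpos := etaOf_pos hc hδ0 hδ
    have hnM : (n : ℝ) ≤ M := by
      refine le_trans ?_ hM
      rw [le_div_iff₀ (sub_pos.mpr hlt)]
      exact mul_le_mul_of_nonneg_left (by linarith) hn0.le
    refine mul_one_sub_rootRate_le_measureReal hout hσ.continuous θ (κ := 2) le_rfl (by norm_num)
      ?_ hN hPX hS
    refine le_trans ?_ (hn.le.trans (measureReal_mono (gapSet_mono hout σ θ hnM le_rfl)))
    linarith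
  · have hδ0 : 0 < δ := lt_trans (by positivity) hδ1
    have hexp := exp_etaOf hc hδ0 hδ
    -- Since δ/2 equals T + 1 times this exponential and the union bound costs only T of them, p = 1
    -- - δ/2 satisfies the strict inequality.
    have hE := Real.exp_pos (-(1 / 8) * etaOf (1 / 8) T δ ^ 2)
    obtain ⟨κ, hκ, hlt⟩ := exists_lt_measureReal_gapSet_relu hr h0 hout θ hb
      (etaOf_pos hc hδ0 hδ).le (etaOf_lt hc hη hδ1 hδ) (p := 1 - δ / 2) (by linarith)
    obtain ⟨m, hm⟩ := exists_nat_ge (2 / κ)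
    have hm1 : 1 ≤ m := by
      have : (0 : ℝ) < m := lt_of_lt_of_le (by positivity) hm
      exact_mod_cast this
    refine ⟨rootRate m, isRootRate_rootRate hm1, ?_⟩
    intro M hM N hN PX hPX Ω _ μ _ B Z hS
    exact mul_one_sub_rootRate_le_measureReal hout continuous_relu θ hm1
      ((div_le_iff₀ hκ).mp hm)
      (hlt.le.trans (measureReal_mono (gapSet_mono hout relu θ hM le_rfl))) hN hPX hS
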